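/- Let $n\ge 1$, $R>0$, $\lambda>0$, $p>0$, $q>0$, let $B_R$ be the open ball of radius $R$ centred at the origin of $\mathbb R^n$, and let $\eta$ be the outward unit normal on $\partial B_R$. Let $u_0$ be a nonnegative, radially symmetric function, smooth on $\overline B_R$ and nondecreasing in $r=|x|$ (that is, $\partial_r u_0\ge 0$), such that $$\frac{\partial u_0}{\partial\eta}=e^{qu_0}\ \text{ on }\partial B_R,\qquad \Delta u_0+\lambda e^{pu_0}\ge 0\ \text{ in }\overline B_R .$$ Let $0<T<\infty$ and let $u$ be a classical solution on $[0,T)$ of $$u_t=\Delta u+\lambda e^{pu}\ \text{ in }B_R\times(0,T),\qquad \frac{\partial u}{\partial\eta}=e^{qu}\ \text{ on }\partial B_R\times(0,T),\qquad u(\cdot,0)=u_0\ \text{ in }B_R,$$ that is, $u$ is continuous on $\overline B_R\times[0,T)$, is of class $C^{2,1}$ in $B_R\times(0,T)$, has a normal derivative (taken from inside the ball) at every point of $\partial B_R\times(0,T)$, and satisfies the three relations pointwise. Suppose that $T$ is the blow-up time of $u$, that is, $\limsup_{t\to T^-}\max_{\overline B_R}|u(\cdot,t)|=\infty$. Then there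 is a constant $c>0$ such that, with $\alpha=\max\{p,q\}$, $$u(x,t)\ \ge\ \log c-\frac{1}{2\alpha}\log(T-t)\qquad\text{for all }x\text{ with }|x|=R\text{ and all }t\in(0,T).$$ -/

import Mathlib

open Set Filter Topology Metric
open scoped Laplacian InnerProductSpace

noncomputable section

/-- `f` has derivative `d` at the point `x ≠ 0` in the direction `x / |x|`, computed from the inner
side. At a point `x` of the sphere `∂B_R` centred at the origin this is the outward normal
derivative `∂f/∂η (x) = d`; it only involves the values of `f` on the closed ball. -/
def HasOutwardNormalDeriv {n : ℕ} (f : EuclideanSpace ℝ (Fin n) → ℝ) (d : ℝ)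
    (x : EuclideanSpace ℝ (Fin n)) : Prop :=
  HasDerivWithinAt (fun s : ℝ => f (x + s • (‖x‖⁻¹ • x))) d (Iic 0) 0

/-- The assumptions on the initial datum `u₀` on the closed ball of radius `R`. -/
structure IsAdmissibleDatum {n : ℕ} (R lam p q : ℝ) (u₀ : EuclideanSpace ℝ (Fin n) → ℝ) :
    Prop where
  smooth : ContDiffOn ℝ ((⊤ : ℕ∞) : WithTop ℕ∞) u₀ (closedBall 0 R)
  nonneg : ∀ x ∈ closedBall (0 : EuclideanSpace ℝ (Fin n)) R, 0 ≤ u₀ x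
  radial : ∀ x ∈ closedBall (0 : EuclideanSpace ℝ (Fin n)) R,
    ∀ y ∈ closedBall (0 : EuclideanSpace ℝ (Fin n)) R, ‖x‖ = ‖y‖ → u₀ x = u₀ y
  /-- `u₀` is nondecreasing in `r = |x|`; for a smooth radial function this is `u₀ᵣ ≥ 0`. -/
  nondecreasing : ∀ x ∈ closedBall (0 : EuclideanSpace ℝ (Fin n)) R,
    ∀ y ∈ closedBall (0 : EuclideanSpace ℝ (Fin n)) R, ‖x‖ ≤ ‖y‖ → u₀ x ≤ u₀ y
  /-- The compatibility condition `∂u₀/∂η = e^{q u₀}` on the sphere. -/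
  compatible : ∀ x ∈ sphere (0 : EuclideanSpace ℝ (Fin n)) R,
    HasOutwardNormalDeriv u₀ (Real.exp (q * u₀ x)) x
  /-- `Δu₀ + λ e^{p u₀} ≥ 0` on the closed ball. -/
  subsolution : ∀ x ∈ closedBall (0 : EuclideanSpace ℝ (Fin n)) R,
    0 ≤ (Δ[closedBall 0 R] u₀) x + lam * Real.exp (p * u₀ x)

/-- `u` is a classical solution on the time interval `[0, T)` of
`u_t = Δu + λ e^{pu}` in `B_R × (0,T)`, `∂u/∂η = e^{qu}` on `∂B_R × (0,T)`, `u(·,0) = u₀`: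
it is continuous on `closure B_R × [0,T)`, of class `C^{2,1}` in `B_R × (0,T)`, and the
normal derivative exists on `∂B_R × (0,T)`. -/
structure IsClassicalSolution {n : ℕ} (R T lam p q : ℝ) (u₀ : EuclideanSpace ℝ (Fin n) → ℝ)
    (u : EuclideanSpace ℝ (Fin n) → ℝ → ℝ) : Prop where
  continuousOn : ContinuousOn (fun z : EuclideanSpace ℝ (Fin n) × ℝ => u z.1 z.2)
    (closedBall 0 R ×ˢ Ico 0 T)
  contDiffOn_space : ∀ t ∈ Ioo 0 T, ContDiffOn ℝ 2 (fun x => u x t) (ball 0 R)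
  continuousOn_fderiv : ContinuousOn
    (fun z : EuclideanSpace ℝ (Fin n) × ℝ => fderiv ℝ (fun y => u y z.2) z.1)
    (ball 0 R ×ˢ Ioo 0 T)
  continuousOn_fderiv_two : ContinuousOn
    (fun z : EuclideanSpace ℝ (Fin n) × ℝ => iteratedFDeriv ℝ 2 (fun y => u y z.2) z.1)
    (ball 0 R ×ˢ Ioo 0 T)
  differentiableAt_time : ∀ x ∈ ball (0 : EuclideanSpace ℝ (Fin n)) R, ∀ t ∈ Ioo 0 T,
    DifferentiableAt ℝ (fun s => u x s) t
  continuousOn_deriv_time : ContinuousOn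
    (fun z : EuclideanSpace ℝ (Fin n) × ℝ => deriv (fun s => u z.1 s) z.2)
    (ball 0 R ×ˢ Ioo 0 T)
  equation : ∀ x ∈ ball (0 : EuclideanSpace ℝ (Fin n)) R, ∀ t ∈ Ioo 0 T,
    deriv (fun s => u x s) t = (Δ (fun y => u y t)) x + lam * Real.exp (p * u x t)
  boundary : ∀ x ∈ sphere (0 : EuclideanSpace ℝ (Fin n)) R, ∀ t ∈ Ioo 0 T,
    HasOutwardNormalDeriv (fun y => u y t) (Real.exp (q * u x t)) x
  initial : ∀ x ∈ ball (0 : EuclideanSpace ℝ (Fin n)) R, u x 0 = u₀ x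

/-- `u` blows up at time `T`: `limsup_{t → T⁻} sup_{|x| ≤ R} |u(x,t)| = ∞`. A classical solution
on `[0, T)` is locally bounded in time, so `T` is then its first blow-up time. -/
def BlowsUpAt {n : ℕ} (R T : ℝ) (u : EuclideanSpace ℝ (Fin n) → ℝ → ℝ) : Prop :=
  ∀ K : ℝ, ∃ᶠ t in 𝓝[<] T, ∃ x ∈ closedBall (0 : EuclideanSpace ℝ (Fin n)) R, K < |u x t|

end

/-! Fix `t` and let `M` be the boundary value of `u` at time `t`. By `le_of_norm_le`, `M` is the
maximum of `u(·,t)` over the ball. With `G = e^{q(M+2)}` and `κ = G/(2R)`, the barrier `M + D(s - t)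
+ e^{κ(|x|² - R²)}` is a supersolution as long as it stays below `M + 2`, so `lt_add_two` keeps `u`
below `M + 2` while `D(s - t) < 1`. Blow-up at `T` therefore forces `D(T - t) ≥ 1`. Since `M ≥ 0`,
every term of `D` is at most a constant times `e^{2αM}`, the quadratic term `G²` giving the factor
2. Taking logarithms of `1 ≤ C e^{2αM}(T - t)` yields the bound.

Monotonicity in the radius comes from two comparisons: `u` with its reflections (so `u` is radial),
then the values of `u` at pairs of points with ordered norms. All comparisons use the first-touching
argument `pos_of_forall_not_first_zero`. -/

/-! ### Second-order calculus: Laplacian at a minimum, isometries, Gaussian weights -/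

/-- The second derivative of `f` along a line, as a value of the second iterated derivative. -/
theorem ContDiffAt.deriv_deriv_line {E : Type*} [NormedAddCommGroup E] [NormedSpace ℝ E]
    {f : E → ℝ} {x : E} (hf : ContDiffAt ℝ 2 f x) (v : E) :
    deriv (deriv fun s : ℝ => f (x + s • v)) 0 = iteratedFDeriv ℝ 2 f x ![v, v] := by
  have hline : ∀ s : ℝ, HasDerivAt (fun s : ℝ => x + s • v) v s := fun s => by
    simpa using ((hasDerivAt_id s).smul_const v).const_add x
  have hcont : Tendsto (fun s : ℝ => x + s • v) (𝓝 0) (𝓝 x) := by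
    have := (hline 0).continuousAt.tendsto
    simpa using this
  have h1 : deriv (fun s : ℝ => f (x + s • v)) =ᶠ[𝓝 0] fun s => fderiv ℝ f (x + s • v) v := by
    filter_upwards [hcont.eventually (hf.eventually (by simp))] with s hs
    exact ((hs.differentiableAt (by simp)).hasFDerivAt.comp_hasDerivAt s (hline s)).deriv
  rw [h1.deriv_eq, iteratedFDeriv_two_apply]
  have hd : DifferentiableAt ℝ (fderiv ℝ f) x :=
    (hf.fderiv_right (m := 1) (by norm_num)).differentiableAt (by simp)
  have h2 : HasFDerivAt (fderiv ℝ f) (fderiv ℝ (fderiv ℝ f) x) (x + (0 : ℝ) • v) := by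
    rw [zero_smul, add_zero]
    exact hd.hasFDerivAt
  have h3 : HasDerivAt (fun s : ℝ => fderiv ℝ f (x + s • v)) (fderiv ℝ (fderiv ℝ f) x v) 0 :=
    h2.comp_hasDerivAt (0 : ℝ) (hline 0)
  have h4 : HasDerivAt (fun s : ℝ => fderiv ℝ f (x + s • v) v) (fderiv ℝ (fderiv ℝ f) x v v) 0 :=
    (ContinuousLinearMap.apply ℝ ℝ v).hasFDerivAt.comp_hasDerivAt (0 : ℝ) h3
  exact h4.deriv

/-- If the second derivative along the line were negative, the minimum would also be a local
maximum, so the function would be locally constant on the line and the second derivative zero. -/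
theorem iteratedFDeriv_two_nonneg_of_isLocalMin {E : Type*} [NormedAddCommGroup E]
    [NormedSpace ℝ E] {f : E → ℝ} {x : E} (hf : ContDiffAt ℝ 2 f x) (hmin : IsLocalMin f x)
    (v : E) : 0 ≤ iteratedFDeriv ℝ 2 f x ![v, v] := by
  rw [← hf.deriv_deriv_line v]
  by_contra! hneg
  have hcont : ContinuousAt (fun s : ℝ => x + s • v) 0 := by fun_prop
  have hlmin : IsLocalMin (fun s : ℝ => f (x + s • v)) 0 := by
    have h0 : Tendsto (fun s : ℝ => x + s • v) (𝓝 0) (𝓝 x) := by simpa using hcont.tendsto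
    filter_upwards [h0.eventually hmin] with s hs
    simpa using hs
  have hfc : ContinuousAt (fun s : ℝ => f (x + s • v)) 0 := by
    have : ContinuousAt f (x + (0 : ℝ) • v) := by simpa using hf.continuousAt
    exact ContinuousAt.comp (f := fun s : ℝ => x + s • v) this hcont
  have hlmax := isLocalMax_of_deriv_deriv_neg hneg hlmin.deriv_eq_zero hfc
  have hconst : (fun s : ℝ => f (x + s • v)) =ᶠ[𝓝 0] fun _ => f x := by
    filter_upwards [hlmin, hlmax] with s h1 h2
    simp only [zero_smul, add_zero] at h1 h2
    exact le_antisymm h2 h1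
  have : deriv (deriv fun s : ℝ => f (x + s • v)) 0 = 0 := by
    rw [hconst.deriv.deriv_eq]; simp
  exact hneg.ne this

theorem laplacian_nonneg_of_isLocalMin {E : Type*} [NormedAddCommGroup E] [InnerProductSpace ℝ E]
    [FiniteDimensional ℝ E] {f : E → ℝ} {x : E} (hf : ContDiffAt ℝ 2 f x)
    (hmin : IsLocalMin f x) : 0 ≤ Δ f x := by
  rw [InnerProductSpace.laplacian_eq_iteratedFDeriv_stdOrthonormalBasis]
  exact Finset.sum_nonneg fun i _ => iteratedFDeriv_two_nonneg_of_isLocalMin hf hmin _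

/-- The Laplacian may be computed in any orthonormal basis, and an isometry carries one such basis
to another. -/
theorem laplacian_comp_linearIsometryEquiv {E : Type*} [NormedAddCommGroup E]
    [InnerProductSpace ℝ E] [FiniteDimensional ℝ E] {f : E → ℝ} (A : E ≃ₗᵢ[ℝ] E) {x : E}
    (hf : ContDiffAt ℝ 2 f (A x)) : Δ (fun y => f (A y)) x = Δ f (A x) := by
  have hfA : ContDiffAt ℝ 2 (fun y => f (A y)) x := hf.comp x A.contDiff.contDiffAt
  rw [InnerProductSpace.laplacian_eq_iteratedFDeriv_stdOrthonormalBasis,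
    InnerProductSpace.laplacian_eq_iteratedFDeriv_orthonormalBasis f
      ((stdOrthonormalBasis ℝ E).map A)]
  refine Finset.sum_congr rfl fun i _ => ?_
  rw [← hfA.deriv_deriv_line, ← hf.deriv_deriv_line]
  simp

/-- The derivative of the Gaussian weight `exp (L |x|²)` along a line. -/
theorem hasDerivAt_exp_mul_norm_sq_line {E : Type*} [NormedAddCommGroup E]
    [InnerProductSpace ℝ E] (L : ℝ) (x v : E) (s : ℝ) :
    HasDerivAt (fun s : ℝ => Real.exp (L * ‖x + s • v‖ ^ 2))
      (2 * L * ⟪x + s • v, v⟫_ℝ * Real.exp (L * ‖x + s • v‖ ^ 2)) s := by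
  have hline : HasDerivAt (fun s : ℝ => x + s • v) v s := by
    simpa using ((hasDerivAt_id s).smul_const v).const_add x
  convert (hline.norm_sq.const_mul L).exp using 1
  ring

theorem contDiff_exp_mul_norm_sq {E : Type*} [NormedAddCommGroup E] [InnerProductSpace ℝ E]
    (L : ℝ) {m : WithTop ℕ∞} : ContDiff ℝ m fun x : E => Real.exp (L * ‖x‖ ^ 2) :=
  (contDiff_const.mul (contDiff_norm_sq ℝ)).exp

theorem laplacian_exp_mul_norm_sq {E : Type*} [NormedAddCommGroup E] [InnerProductSpace ℝ E]
    [FiniteDimensional ℝ E] (L : ℝ) (x : E) :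
    Δ (fun y : E => Real.exp (L * ‖y‖ ^ 2)) x =
      (2 * L * Module.finrank ℝ E + 4 * L ^ 2 * ‖x‖ ^ 2) * Real.exp (L * ‖x‖ ^ 2) := by
  rw [InnerProductSpace.laplacian_eq_iteratedFDeriv_stdOrthonormalBasis]
  have key : ∀ v : E, ‖v‖ = 1 → iteratedFDeriv ℝ 2 (fun y : E => Real.exp (L * ‖y‖ ^ 2)) x ![v, v]
      = (2 * L + 4 * L ^ 2 * ‖⟪v, x⟫_ℝ‖ ^ 2) * Real.exp (L * ‖x‖ ^ 2) := by
    intro v hv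
    rw [← (contDiff_exp_mul_norm_sq L).contDiffAt.deriv_deriv_line v]
    have h1 : deriv (fun s : ℝ => Real.exp (L * ‖x + s • v‖ ^ 2)) =
        fun s => 2 * L * ⟪x + s • v, v⟫_ℝ * Real.exp (L * ‖x + s • v‖ ^ 2) :=
      funext fun s => (hasDerivAt_exp_mul_norm_sq_line L x v s).deriv
    rw [h1]
    have h2 : HasDerivAt (fun s : ℝ => 2 * L * ⟪x + s • v, v⟫_ℝ) (2 * L) 0 := by
      have : (fun s : ℝ => 2 * L * ⟪x + s • v, v⟫_ℝ) = fun s => 2 * L * (⟪x, v⟫_ℝ + s) := by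
        funext s
        rw [inner_add_left, real_inner_smul_left, real_inner_self_eq_norm_sq, hv]; ring
      rw [this]
      simpa using ((hasDerivAt_id (0 : ℝ)).const_add ⟪x, v⟫_ℝ).const_mul (2 * L)
    refine (h2.mul (hasDerivAt_exp_mul_norm_sq_line L x v 0)).deriv.trans ?_
    simp only [zero_smul, add_zero, Real.norm_eq_abs, sq_abs, real_inner_comm x v]
    ring
  beta_reduce
  rw [Finset.sum_congr rfl fun i _ => key _ ((stdOrthonormalBasis ℝ E).norm_eq_one i),
    ← Finset.sum_mul, Finset.sum_add_distrib, ← Finset.mul_sum,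
    ← Finset.mul_sum, (stdOrthonormalBasis ℝ E).sum_sq_norm_inner_right]
  simp; ring

/-! ### Touching arguments and the linearised exponential -/

/-- A function bounded below by its value at the right end point has nonpositive left
derivative there. -/
theorem HasDerivWithinAt.nonpos_of_le_left {f : ℝ → ℝ} {d t : ℝ}
    (hf : HasDerivWithinAt f d (Iic t) t) (h : ∀ᶠ s in 𝓝[<] t, f t ≤ f s) : d ≤ 0 := by
  have h1 := hasDerivWithinAt_iff_tendsto_slope.1 hf
  rw [Iic_sdiff_right] at h1
  refine le_of_tendsto h1 ?_
  filter_upwards [h, self_mem_nhdsWithin] with s hs hst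
  rw [slope_def_field]
  exact div_nonpos_of_nonneg_of_nonpos (sub_nonneg.2 hs) (sub_nonpos.2 (le_of_lt hst))

/-- The first-touching principle: a continuous function on a compact set times `[a, b]`, positive
at time `a`, stays positive if it admits no first zero. -/
theorem pos_of_forall_not_first_zero {X : Type*} [TopologicalSpace X] [T2Space X] {K : Set X}
    (hK : IsCompact K) {a b : ℝ} {g : X → ℝ → ℝ}
    (hg : ContinuousOn (fun z : X × ℝ => g z.1 z.2) (K ×ˢ Icc a b))
    (ha : ∀ x ∈ K, 0 < g x a)
    (hzero : ∀ x ∈ K, ∀ t ∈ Ioc a b, g x t = 0 → (∀ y ∈ K, 0 ≤ g y t) →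
      (∀ s ∈ Ico a t, 0 ≤ g x s) → False) :
    ∀ x ∈ K, ∀ t ∈ Icc a b, 0 < g x t := by
  intro x₀ hx₀ t₀ ht₀
  by_contra! hneg
  -- The set where `g ≤ 0` is compact, so it has a point of least time. Before that time `g` is
  -- positive on `K`, and by continuity `g` vanishes at the point itself.
  let Z : Set (X × ℝ) := {z | z ∈ K ×ˢ Icc a b ∧ g z.1 z.2 ≤ 0}
  obtain ⟨⟨x, t⟩, ⟨⟨hx, ht⟩, hxt⟩, hmin⟩ : ∃ z ∈ Z, IsMinOn Prod.snd Z z := by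
    have hclosed : IsClosed Z :=
      hg.preimage_isClosed_of_isClosed (hK.isClosed.prod isClosed_Icc) isClosed_Iic
    have hcomp : IsCompact Z := (hK.prod isCompact_Icc).of_isClosed_subset hclosed fun z hz => hz.1
    exact hcomp.exists_isMinOn ⟨(x₀, t₀), ⟨hx₀, ht₀⟩, hneg⟩ continuous_snd.continuousOn
  simp only at hx ht hxt
  have hpos : ∀ y ∈ K, ∀ s ∈ Ico a t, 0 < g y s := by
    intro y hy s hs
    by_contra! h
    have : t ≤ s := hmin (a := (y, s)) ⟨⟨hy, hs.1, hs.2.le.trans ht.2⟩, h⟩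
    exact absurd hs.2 this.not_gt
  have hat : a < t := by
    refine lt_of_le_of_ne ht.1 ?_
    rintro rfl
    exact absurd (ha x hx) hxt.not_gt
  have hnn : ∀ y ∈ K, 0 ≤ g y t := by
    intro y hy
    have hc : ContinuousOn (g y) (Icc a b) :=
      hg.comp (f := fun s : ℝ => (y, s)) (by fun_prop) fun s hs => ⟨hy, hs⟩
    have hsub : Ico a t ⊆ Icc a b := fun s hs => ⟨hs.1, hs.2.le.trans ht.2⟩
    have hlim : Tendsto (g y) (𝓝[Ico a t] t) (𝓝 (g y t)) :=
      (hc t ht).mono_left (nhdsWithin_mono _ hsub)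
    have : (𝓝[Ico a t] t).NeBot := by
      rw [← mem_closure_iff_nhdsWithin_neBot, closure_Ico hat.ne]
      exact right_mem_Icc.2 hat.le
    refine ge_of_tendsto hlim ?_
    filter_upwards [self_mem_nhdsWithin] with s hs
    exact (hpos y hy s hs).le
  exact hzero x hx t ⟨hat, ht.2⟩ (le_antisymm hxt (hnn x hx)) hnn fun s hs => (hpos x hx s hs).le

theorem laplacian_le_of_isLocalMin_sub {E : Type*} [NormedAddCommGroup E] [InnerProductSpace ℝ E]
    [FiniteDimensional ℝ E] {f h : E → ℝ} {x : E} (hf : ContDiffAt ℝ 2 f x)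
    (hh : ContDiffAt ℝ 2 h x) (hmin : IsLocalMin (fun y => h y - f y) x) : Δ f x ≤ Δ h x := by
  have h1 := laplacian_nonneg_of_isLocalMin (hh.sub hf) hmin
  have h2 := hh.laplacian_sub hf
  have h3 : Δ (fun y => h y - f y) x = Δ h x - Δ f x := h2
  linarith

theorem laplacian_const_add_mul_exp {E : Type*} [NormedAddCommGroup E] [InnerProductSpace ℝ E]
    [FiniteDimensional ℝ E] (a c L : ℝ) (x : E) :
    Δ (fun y : E => a + c * Real.exp (L * ‖y‖ ^ 2)) x =
      (2 * L * Module.finrank ℝ E + 4 * L ^ 2 * ‖x‖ ^ 2) * (c * Real.exp (L * ‖x‖ ^ 2)) := by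
  have he : ContDiffAt ℝ 2 (fun y : E => Real.exp (L * ‖y‖ ^ 2)) x :=
    (contDiff_exp_mul_norm_sq L).contDiffAt
  have h1 : Δ ((fun _ : E => a) + c • fun y : E => Real.exp (L * ‖y‖ ^ 2)) x =
      Δ (fun _ : E => a) x + Δ (c • fun y : E => Real.exp (L * ‖y‖ ^ 2)) x :=
    contDiffAt_const.laplacian_add (he.const_smul c)
  rw [InnerProductSpace.laplacian_smul c he, laplacian_exp_mul_norm_sq,
    InnerProductSpace.laplacian_const] at h1
  have h2 : (fun y : E => a + c * Real.exp (L * ‖y‖ ^ 2)) =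
      (fun _ : E => a) + c • fun y : E => Real.exp (L * ‖y‖ ^ 2) := rfl
  rw [h2, h1]
  simp only [Pi.zero_apply, smul_eq_mul]
  ring

/-- The tangent-line inequality for the exponential gives a one-sided Lipschitz bound below the
level `B`. It linearises both the reaction and the boundary flux. -/
theorem exp_mul_sub_exp_mul_le {k a c B : ℝ} (hk : 0 ≤ k) (hac : a ≤ c) (hc : c ≤ B) :
    Real.exp (k * c) - Real.exp (k * a) ≤ k * Real.exp (k * B) * (c - a) := by
  have h1 : Real.exp (k * a) = Real.exp (k * c) * Real.exp (k * a - k * c) := by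
    rw [← Real.exp_add]; ring_nf
  have h2 := Real.add_one_le_exp (k * a - k * c)
  have h3 : Real.exp (k * c) ≤ Real.exp (k * B) := Real.exp_le_exp.2 (by gcongr)
  have h4 : Real.exp (k * c) * (k * a - k * c + 1) ≤ Real.exp (k * a) := by
    rw [h1]; gcongr
  have h5 : Real.exp (k * c) * (k * (c - a)) ≤ Real.exp (k * B) * (k * (c - a)) := by
    have : 0 ≤ k * (c - a) := mul_nonneg hk (sub_nonneg.2 hac)
    gcongr
  linarith

/-! ### Outward normal derivatives and the minimum principle on a ball -/

section OutwardNormal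

variable {n : ℕ} {R : ℝ} {f : EuclideanSpace ℝ (Fin n) → ℝ} {d : ℝ}
  {x : EuclideanSpace ℝ (Fin n)}

/-- The outward normal derivative at a point of the sphere is nonpositive if the function has a
minimum there relative to an annulus. -/
theorem HasOutwardNormalDeriv.nonpos_of_le {r : ℝ} (h : HasOutwardNormalDeriv f d x)
    (hr : 0 ≤ r) (hrR : r < R) (hx : x ∈ sphere (0 : EuclideanSpace ℝ (Fin n)) R)
    (hle : ∀ y ∈ closedBall (0 : EuclideanSpace ℝ (Fin n)) R, r ≤ ‖y‖ → f x ≤ f y) : d ≤ 0 := by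
  have hxR : ‖x‖ = R := by simpa using hx
  have hR : 0 < R := hr.trans_lt hrR
  refine HasDerivWithinAt.nonpos_of_le_left h ?_
  have hmem : Ioo (r - R) 0 ∈ 𝓝[<] (0 : ℝ) := Ioo_mem_nhdsLT (by linarith)
  filter_upwards [hmem] with s hs
  have hnorm : ‖x + s • (‖x‖⁻¹ • x)‖ = R + s := by
    have : x + s • (‖x‖⁻¹ • x) = (1 + s * R⁻¹) • x := by
      rw [hxR, add_smul, one_smul, smul_smul]
    have hfac : (1 + s * R⁻¹) * R = R + s := by field_simp
    rw [this, norm_smul, hxR, Real.norm_eq_abs, ← abs_of_pos hR, ← abs_mul, abs_of_pos hR, hfac,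
      abs_of_pos (by linarith [hs.1])]
  simp only [zero_smul, add_zero]
  refine hle _ ?_ ?_
  · rw [mem_closedBall_zero_iff, hnorm]; linarith [hs.2]
  · rw [hnorm]; linarith [hs.1]

theorem hasOutwardNormalDeriv_const_add_mul_exp (a c L : ℝ)
    (x : EuclideanSpace ℝ (Fin n)) :
    HasOutwardNormalDeriv (fun y => a + c * Real.exp (L * ‖y‖ ^ 2))
      (2 * L * ‖x‖ * (c * Real.exp (L * ‖x‖ ^ 2))) x := by
  have h := ((hasDerivAt_exp_mul_norm_sq_line L x (‖x‖⁻¹ • x) 0).const_mul c).const_add a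
  refine HasDerivAt.hasDerivWithinAt ?_
  convert h using 1
  rw [zero_smul, add_zero, real_inner_smul_right, real_inner_self_eq_norm_sq]
  rcases eq_or_ne ‖x‖ 0 with h0 | h0
  · simp [h0]
  · field_simp

theorem HasOutwardNormalDeriv.comp_linearIsometryEquiv
    (A : EuclideanSpace ℝ (Fin n) ≃ₗᵢ[ℝ] EuclideanSpace ℝ (Fin n))
    (h : HasOutwardNormalDeriv f d (A x)) : HasOutwardNormalDeriv (fun y => f (A y)) d x := by
  simpa [HasOutwardNormalDeriv] using h

/-- Strict minimum principle on a closed ball. -/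
theorem pos_on_closedBall {a b : ℝ} (hR : 0 < R)
    {g : EuclideanSpace ℝ (Fin n) → ℝ → ℝ}
    (hg : ContinuousOn (fun z : EuclideanSpace ℝ (Fin n) × ℝ => g z.1 z.2)
      (closedBall 0 R ×ˢ Icc a b))
    (ha : ∀ x ∈ closedBall (0 : EuclideanSpace ℝ (Fin n)) R, 0 < g x a)
    (hint : ∀ x ∈ ball (0 : EuclideanSpace ℝ (Fin n)) R, ∀ t ∈ Ioc a b, g x t = 0 →
      IsLocalMin (fun y => g y t) x → ∃ d, 0 < d ∧ HasDerivAt (g x) d t)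
    (hbd : ∀ x ∈ sphere (0 : EuclideanSpace ℝ (Fin n)) R, ∀ t ∈ Ioc a b, g x t = 0 →
      ∃ d, 0 < d ∧ HasOutwardNormalDeriv (fun y => g y t) d x) :
    ∀ x ∈ closedBall (0 : EuclideanSpace ℝ (Fin n)) R, ∀ t ∈ Icc a b, 0 < g x t := by
  refine pos_of_forall_not_first_zero (isCompact_closedBall _ _) hg ha ?_
  intro x hx t ht h0 hy hs
  -- At a first zero the time derivative (interior case) or the outward normal derivative (boundary
  -- case) is nonpositive, against `hint` or `hbd`.
  rcases (mem_closedBall_zero_iff.1 hx).lt_or_eq with hlt | heq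
  · have hxb : x ∈ ball (0 : EuclideanSpace ℝ (Fin n)) R := mem_ball_zero_iff.2 hlt
    have hmin : IsLocalMin (fun y => g y t) x := by
      filter_upwards [isOpen_ball.mem_nhds hxb] with y hyb
      rw [h0]
      exact hy y (ball_subset_closedBall hyb)
    obtain ⟨d, hd, hder⟩ := hint x hxb t ht h0 hmin
    refine hd.not_ge (HasDerivWithinAt.nonpos_of_le_left hder.hasDerivWithinAt ?_)
    filter_upwards [Ioo_mem_nhdsLT ht.1] with s hst
    rw [h0]
    exact hs s ⟨hst.1.le, hst.2⟩
  · have hxs : x ∈ sphere (0 : EuclideanSpace ℝ (Fin n)) R := mem_sphere_zero_iff_norm.2 heq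
    obtain ⟨d, hd, hder⟩ := hbd x hxs t ht h0
    refine hd.not_ge (hder.nonpos_of_le le_rfl hR hxs fun y hyb _ => ?_)
    rw [h0]
    exact hy y hyb

end OutwardNormal

/-! ### Positivity, symmetry, radial monotonicity and the barrier -/

namespace IsClassicalSolution

variable {n : ℕ} {R T lam p q : ℝ} {u₀ : EuclideanSpace ℝ (Fin n) → ℝ}
  {u : EuclideanSpace ℝ (Fin n) → ℝ → ℝ}

theorem contDiffAt (hu : IsClassicalSolution R T lam p q u₀ u) {x : EuclideanSpace ℝ (Fin n)}
    (hx : x ∈ ball 0 R) {t : ℝ} (ht : t ∈ Ioo 0 T) : ContDiffAt ℝ 2 (fun y => u y t) x :=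
  (hu.contDiffOn_space t ht).contDiffAt (isOpen_ball.mem_nhds hx)

theorem hasDerivAt_time (hu : IsClassicalSolution R T lam p q u₀ u)
    {x : EuclideanSpace ℝ (Fin n)} (hx : x ∈ ball 0 R) {t : ℝ} (ht : t ∈ Ioo 0 T) :
    HasDerivAt (u x) (Δ (fun y => u y t) x + lam * Real.exp (p * u x t)) t := by
  rw [← hu.equation x hx t ht]
  exact (hu.differentiableAt_time x hx t ht).hasDerivAt

theorem initial_closedBall (hu : IsClassicalSolution R T lam p q u₀ u) (hR : 0 < R) (hT : 0 < T)
    (hu₀ : ContinuousOn u₀ (closedBall 0 R)) {x : EuclideanSpace ℝ (Fin n)}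
    (hx : x ∈ closedBall 0 R) : u x 0 = u₀ x := by
  have hc : ContinuousOn (fun x => u x 0) (closedBall 0 R) :=
    hu.continuousOn.comp (f := fun x => (x, (0 : ℝ))) (by fun_prop)
      fun y hy => ⟨hy, left_mem_Ico.2 hT⟩
  exact EqOn.of_subset_closure (s := ball 0 R) (fun y hy => hu.initial y hy) hc hu₀
    ball_subset_closedBall (closure_ball _ hR.ne').ge hx

theorem exists_bound (hu : IsClassicalSolution R T lam p q u₀ u) {b : ℝ} (hb : b < T) :
    ∃ B, ∀ x ∈ closedBall (0 : EuclideanSpace ℝ (Fin n)) R, ∀ t ∈ Icc 0 b, u x t ≤ B := by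
  have hc : ContinuousOn (fun z : EuclideanSpace ℝ (Fin n) × ℝ => u z.1 z.2)
      (closedBall 0 R ×ˢ Icc 0 b) :=
    hu.continuousOn.mono (prod_mono le_rfl fun t ht => ⟨ht.1, ht.2.trans_lt hb⟩)
  obtain ⟨B, hB⟩ := (((isCompact_closedBall _ _).prod isCompact_Icc).image_of_continuousOn hc).bddAbove
  exact ⟨B, fun x hx t ht => hB ⟨(x, t), ⟨hx, ht⟩, rfl⟩⟩

/-- Nonnegativity of the solution is inherited from the initial datum. -/
theorem nonneg (hu : IsClassicalSolution R T lam p q u₀ u) (hR : 0 < R) (hlam : 0 < lam)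
    (h₀ : ∀ x ∈ closedBall (0 : EuclideanSpace ℝ (Fin n)) R, 0 ≤ u x 0)
    {x : EuclideanSpace ℝ (Fin n)} (hx : x ∈ closedBall 0 R) {t : ℝ} (ht : t ∈ Ico 0 T) :
    0 ≤ u x t := by
  refine le_of_forall_pos_le_add fun ε hε => ?_
  have hIoo : ∀ s ∈ Ioc 0 t, s ∈ Ioo 0 T := fun s hs => ⟨hs.1, hs.2.trans_lt ht.2⟩
  -- The shift by `ε` is needed only for strict positivity at time 0; later the reaction and the
  -- flux are themselves strictly positive.
  refine (pos_on_closedBall (a := 0) (b := t) (g := fun x t => u x t + ε) hR ?_ ?_ ?_ ?_ x hx t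
    ⟨ht.1, le_rfl⟩).le
  · exact (hu.continuousOn.mono
      (prod_mono le_rfl fun s hs => ⟨hs.1, hs.2.trans_lt ht.2⟩)).add continuousOn_const
  · intro y hy
    linarith [h₀ y hy]
  · intro y hy s hs _ hmin
    refine ⟨_, ?_, (hu.hasDerivAt_time hy (hIoo s hs)).add_const ε⟩
    have hmin' : IsLocalMin (fun z => u z s) y := by
      filter_upwards [hmin] with z hz
      linarith
    have := laplacian_nonneg_of_isLocalMin (hu.contDiffAt hy (hIoo s hs)) hmin'
    positivity
  · intro y hy s hs _
    exact ⟨_, Real.exp_pos _, (hu.boundary y hy s (hIoo s hs)).add_const ε⟩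

/-- Comparison of a solution with its composition with a linear isometry. -/
theorem comp_linearIsometryEquiv_le (hu : IsClassicalSolution R T lam p q u₀ u) (hR : 0 < R)
    (hlam : 0 < lam) (hp : 0 < p) (hq : 0 < q)
    (A : EuclideanSpace ℝ (Fin n) ≃ₗᵢ[ℝ] EuclideanSpace ℝ (Fin n))
    (h₀ : ∀ x ∈ closedBall (0 : EuclideanSpace ℝ (Fin n)) R, u (A x) 0 = u x 0)
    {x : EuclideanSpace ℝ (Fin n)} (hx : x ∈ closedBall 0 R) {t : ℝ} (ht : t ∈ Ico 0 T) :
    u (A x) t ≤ u x t := by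
  obtain ⟨B, hB⟩ := hu.exists_bound ht.2
  have hIoo : ∀ s ∈ Ioc 0 t, s ∈ Ioo 0 T := fun s hs => ⟨hs.1, hs.2.trans_lt ht.2⟩
  have hIcc : ∀ s ∈ Icc 0 t, s ∈ Ico 0 T := fun s hs => ⟨hs.1, hs.2.trans_lt ht.2⟩
  have hAcb : ∀ y ∈ closedBall (0 : EuclideanSpace ℝ (Fin n)) R, A y ∈ closedBall 0 R :=
    fun y hy => by simpa using hy
  have hAb : ∀ y ∈ ball (0 : EuclideanSpace ℝ (Fin n)) R, A y ∈ ball 0 R :=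
    fun y hy => by simpa using hy
  set Cf := lam * (p * Real.exp (p * B)) with hCf
  set Cg := q * Real.exp (q * B) with hCg
  have hCg0 : 0 < Cg := by positivity
  -- On the sphere the weight `e^{L|x|²}` has logarithmic normal derivative `2LR = Cg + 1`, one more
  -- than the Lipschitz constant of the flux. The rate `k` then exceeds by one the Laplacian of the
  -- weight plus the Lipschitz constant of the reaction.
  set L := (Cg + 1) / (2 * R) with hL
  have hL0 : 0 < L := by positivity
  have hLR : 2 * L * R = Cg + 1 := by rw [hL]; field_simp
  set k := 2 * L * n + 4 * L ^ 2 * R ^ 2 + Cf + 1 with hk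
  have key : ∀ ε > 0, 0 < u x t - u (A x) t + ε * Real.exp (k * t) * Real.exp (L * ‖x‖ ^ 2) := by
    intro ε hε
    refine pos_on_closedBall (a := 0) (b := t)
      (g := fun x t => u x t - u (A x) t + ε * Real.exp (k * t) * Real.exp (L * ‖x‖ ^ 2))
      hR ?_ ?_ ?_ ?_ x hx t ⟨ht.1, le_rfl⟩
    · refine (ContinuousOn.sub ?_ ?_).add (by fun_prop)
      · exact hu.continuousOn.mono (prod_mono le_rfl hIcc)
      · refine hu.continuousOn.comp
          (f := fun z : EuclideanSpace ℝ (Fin n) × ℝ => (A z.1, z.2)) (by fun_prop) ?_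
        exact fun z hz => ⟨hAcb _ hz.1, hIcc _ hz.2⟩
    · intro y hy
      rw [h₀ y hy, sub_self, zero_add]
      positivity
    · intro y hy s hs h0 hmin
      have hsT := hIoo s hs
      have hφ : 0 < ε * Real.exp (k * s) * Real.exp (L * ‖y‖ ^ 2) := by positivity
      refine ⟨_, ?_, ((hu.hasDerivAt_time hy hsT).sub (hu.hasDerivAt_time (hAb y hy) hsT)).add
        ((((hasDerivAt_id s).const_mul k).exp.const_mul ε).mul_const (Real.exp (L * ‖y‖ ^ 2)))⟩
      have hyA := hu.contDiffAt (hAb y hy) hsT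
      have hcA : ContDiffAt ℝ 2 (fun z => u (A z) s) y :=
        hyA.comp y A.contDiff.contDiffAt
      have hcφ : ContDiffAt ℝ 2
          (fun z => 0 + ε * Real.exp (k * s) * Real.exp (L * ‖z‖ ^ 2)) y :=
        contDiffAt_const.add (contDiffAt_const.mul (contDiff_exp_mul_norm_sq L).contDiffAt)
      have hcu := hu.contDiffAt hy hsT
      have hlap : Δ (fun z => u (A z) s) y ≤
          Δ ((fun z => u z s) + fun z : EuclideanSpace ℝ (Fin n) =>
            0 + ε * Real.exp (k * s) * Real.exp (L * ‖z‖ ^ 2) : EuclideanSpace ℝ (Fin n) → ℝ) y := by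
        refine laplacian_le_of_isLocalMin_sub hcA (hcu.add hcφ) ?_
        filter_upwards [hmin] with z hz
        simp only [Pi.add_apply]
        linarith
      rw [hcu.laplacian_add hcφ, laplacian_const_add_mul_exp,
        laplacian_comp_linearIsometryEquiv A hyA, finrank_euclideanSpace_fin] at hlap
      have hyR : ‖y‖ ^ 2 ≤ R ^ 2 := by
        have := (mem_ball_zero_iff.1 hy).le
        gcongr
      have hexp := exp_mul_sub_exp_mul_le hp.le (a := u y s) (c := u (A y) s) (by linarith)
        (hB _ (hAcb y (ball_subset_closedBall hy)) s ⟨hs.1.le, hs.2⟩)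
      have hexp' := mul_le_mul_of_nonneg_left hexp hlam.le
      have hdiff : u (A y) s - u y s = ε * Real.exp (k * s) * Real.exp (L * ‖y‖ ^ 2) := by linarith
      rw [hdiff] at hexp'
      simp only [id, mul_one]
      set φ := ε * Real.exp (k * s) * Real.exp (L * ‖y‖ ^ 2)
      have h1 : (2 * L * n + 4 * L ^ 2 * ‖y‖ ^ 2) * φ ≤ (2 * L * n + 4 * L ^ 2 * R ^ 2) * φ := by
        gcongr
      have h2 : ε * (Real.exp (k * s) * k) * Real.exp (L * ‖y‖ ^ 2) = k * φ := by ring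
      have h3 : k * φ = (2 * L * n + 4 * L ^ 2 * R ^ 2) * φ +
          lam * (p * Real.exp (p * B) * φ) + φ := by rw [hk, hCf]; ring
      rw [h2, h3]
      linarith
    · intro y hy s hs h0
      have hsT := hIoo s hs
      have hφ : 0 < ε * Real.exp (k * s) * Real.exp (L * ‖y‖ ^ 2) := by positivity
      have hyn : ‖y‖ = R := mem_sphere_zero_iff_norm.1 hy
      have hyA : A y ∈ sphere (0 : EuclideanSpace ℝ (Fin n)) R := by simpa using hy
      have hder := ((hu.boundary y hy s hsT).sub
        (HasOutwardNormalDeriv.comp_linearIsometryEquiv A (hu.boundary (A y) hyA s hsT))).add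
        (hasOutwardNormalDeriv_const_add_mul_exp 0 (ε * Real.exp (k * s)) L y)
      refine ⟨_, ?_, hder.congr_deriv rfl |>.congr (fun z _ => ?_) ?_⟩
      · have hexp := exp_mul_sub_exp_mul_le hq.le (a := u y s) (c := u (A y) s) (by linarith)
          (hB _ (hAcb y (sphere_subset_closedBall hy)) s ⟨hs.1.le, hs.2⟩)
        have hdiff : u (A y) s - u y s = ε * Real.exp (k * s) * Real.exp (L * ‖y‖ ^ 2) := by
          linarith
        rw [hdiff, ← hCg] at hexp
        rw [hyn, hLR, ← hyn]
        linarith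
      · simp
      · simp
  refine le_of_forall_pos_le_add fun δ hδ => ?_
  have := key (δ / (Real.exp (k * t) * Real.exp (L * ‖x‖ ^ 2))) (by positivity)
  have h2 : δ / (Real.exp (k * t) * Real.exp (L * ‖x‖ ^ 2)) * Real.exp (k * t) *
      Real.exp (L * ‖x‖ ^ 2) = δ := by field_simp
  linarith

/-- A solution with radial initial datum is radial. -/
theorem eq_of_norm_eq (hu : IsClassicalSolution R T lam p q u₀ u) (hR : 0 < R)
    (hlam : 0 < lam) (hp : 0 < p) (hq : 0 < q)
    (h₀ : ∀ x ∈ closedBall (0 : EuclideanSpace ℝ (Fin n)) R,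
      ∀ y ∈ closedBall (0 : EuclideanSpace ℝ (Fin n)) R, ‖x‖ = ‖y‖ → u x 0 = u y 0)
    {x y : EuclideanSpace ℝ (Fin n)} (hx : x ∈ closedBall 0 R) (hxy : ‖x‖ = ‖y‖)
    {t : ℝ} (ht : t ∈ Ico 0 T) : u x t = u y t := by
  have hle : ∀ {x y : EuclideanSpace ℝ (Fin n)}, x ∈ closedBall 0 R → ‖x‖ = ‖y‖ →
      u y t ≤ u x t := by
    intro x y hx hxy
    -- For points of equal norm, reflection in the hyperplane orthogonal to `x - y` sends `x` to
    -- `y`.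
    have h := hu.comp_linearIsometryEquiv_le hR hlam hp hq (ℝ ∙ (x - y))ᗮ.reflection
      (fun z hz => h₀ _ (by simpa using hz) _ hz (by simp)) hx ht
    rwa [Submodule.reflection_sub hxy] at h
  have hy : y ∈ closedBall (0 : EuclideanSpace ℝ (Fin n)) R := by
    rw [mem_closedBall_zero_iff] at hx ⊢
    rwa [← hxy]
  exact le_antisymm (hle hy hxy.symm) (hle hx hxy)

/-- A solution with radial, radially nondecreasing initial datum is radially nondecreasing. -/
theorem le_of_norm_le (hu : IsClassicalSolution R T lam p q u₀ u) (hR : 0 < R)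
    (hlam : 0 < lam) (hp : 0 < p) (hq : 0 < q)
    (h₀ : ∀ x ∈ closedBall (0 : EuclideanSpace ℝ (Fin n)) R,
      ∀ y ∈ closedBall (0 : EuclideanSpace ℝ (Fin n)) R, ‖x‖ ≤ ‖y‖ → u x 0 ≤ u y 0)
    {x y : EuclideanSpace ℝ (Fin n)} (hx : x ∈ closedBall 0 R) (hyx : ‖y‖ ≤ ‖x‖)
    {t : ℝ} (ht : t ∈ Ico 0 T) : u y t ≤ u x t := by
  obtain ⟨B, hB⟩ := hu.exists_bound ht.2
  have hIoo : ∀ s ∈ Ioc 0 t, s ∈ Ioo 0 T := fun s hs => ⟨hs.1, hs.2.trans_lt ht.2⟩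
  have hIcc : ∀ s ∈ Icc 0 t, s ∈ Ico 0 T := fun s hs => ⟨hs.1, hs.2.trans_lt ht.2⟩
  set Cf := lam * (p * Real.exp (p * B)) with hCf
  set k := Cf + 1 with hk
  -- Doubling the variables makes monotonicity a positivity statement on ordered pairs, so no radial
  -- derivative of `u` is needed.
  let K : Set (EuclideanSpace ℝ (Fin n) × EuclideanSpace ℝ (Fin n)) :=
    (closedBall 0 R ×ˢ closedBall 0 R) ∩ {z | ‖z.2‖ ≤ ‖z.1‖}
  have hK : IsCompact K := ((isCompact_closedBall _ _).prod (isCompact_closedBall _ _)).inter_right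
    (isClosed_le (by fun_prop) (by fun_prop))
  have hy : y ∈ closedBall (0 : EuclideanSpace ℝ (Fin n)) R := by
    rw [mem_closedBall_zero_iff] at hx ⊢
    exact hyx.trans hx
  have key : ∀ ε > 0, 0 < u x t - u y t + ε * Real.exp (k * t) := by
    intro ε hε
    refine pos_of_forall_not_first_zero hK (a := 0) (b := t)
      (g := fun z t => u z.1 t - u z.2 t + ε * Real.exp (k * t)) ?_ ?_ ?_ (x, y)
      ⟨⟨hx, hy⟩, hyx⟩ t ⟨ht.1, le_rfl⟩
    · refine (ContinuousOn.sub ?_ ?_).add (by fun_prop)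
      · exact hu.continuousOn.comp (f := fun z : (EuclideanSpace ℝ (Fin n) ×
          EuclideanSpace ℝ (Fin n)) × ℝ => (z.1.1, z.2)) (by fun_prop)
          fun z hz => ⟨hz.1.1.1, hIcc _ hz.2⟩
      · exact hu.continuousOn.comp (f := fun z : (EuclideanSpace ℝ (Fin n) ×
          EuclideanSpace ℝ (Fin n)) × ℝ => (z.1.2, z.2)) (by fun_prop)
          fun z hz => ⟨hz.1.1.2, hIcc _ hz.2⟩
    · rintro ⟨z, w⟩ ⟨⟨hz, hw⟩, hwz⟩
      have h1 := h₀ w hw z hz hwz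
      have h2 : 0 < ε * Real.exp (k * 0) := by positivity
      dsimp only
      linarith
    · rintro ⟨z, w⟩ ⟨⟨hz, hw⟩, hwz⟩ s hs h0 hmin hpast
      simp only [mem_ofPred_eq] at hwz h0 hpast
      have hsT := hIoo s hs
      have hφ : 0 < ε * Real.exp (k * s) := by positivity
      -- On the diagonal `‖w‖ = ‖z‖` radial symmetry reduces the perturbed difference to `ε e^{ks} >
      -- 0`. Hence a zero occurs off the diagonal, where `z` and `w` can be varied independently,
      -- and `w` is interior.
      have hlt : ‖w‖ < ‖z‖ := by
        refine lt_of_le_of_ne hwz fun heq => ?_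
        have := hu.eq_of_norm_eq hR hlam hp hq
          (fun a ha b hb hab => le_antisymm (h₀ a ha b hb hab.le) (h₀ b hb a ha hab.ge))
          hw heq ⟨hsT.1.le, hsT.2⟩
        linarith
      rw [mem_closedBall_zero_iff] at hz hw
      have hwR : ‖w‖ < R := hlt.trans_le hz
      have hwb : w ∈ ball (0 : EuclideanSpace ℝ (Fin n)) R := mem_ball_zero_iff.2 hwR
      have hminz : ∀ z' ∈ closedBall (0 : EuclideanSpace ℝ (Fin n)) R, ‖w‖ ≤ ‖z'‖ →
          u z s ≤ u z' s := by
        intro z' hz' hwz'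
        have := hmin (z', w) ⟨⟨hz', ball_subset_closedBall hwb⟩, hwz'⟩
        dsimp only at this
        linarith
      rcases hz.lt_or_eq with hzR | hzR
      · have hzb : z ∈ ball (0 : EuclideanSpace ℝ (Fin n)) R := mem_ball_zero_iff.2 hzR
        have hlmin : IsLocalMin (fun z => u z s) z := by
          filter_upwards [isOpen_ball.mem_nhds hzb,
            (continuous_norm.isOpen_preimage _ isOpen_Ioi).mem_nhds
              (show z ∈ norm ⁻¹' Ioi ‖w‖ from hlt)] with z' hz' hwz'
          exact hminz z' (ball_subset_closedBall hz') (le_of_lt hwz')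
        have hlmax : IsLocalMin (fun w => 0 - u w s) w := by
          filter_upwards [isOpen_ball.mem_nhds hwb,
            (continuous_norm.isOpen_preimage _ isOpen_Iio).mem_nhds
              (show w ∈ norm ⁻¹' Iio ‖z‖ from hlt)] with w' hw' hwz'
          have := hmin (z, w') ⟨⟨ball_subset_closedBall hzb, ball_subset_closedBall hw'⟩,
            (show ‖w'‖ ≤ ‖z‖ from le_of_lt hwz')⟩
          dsimp only at this ⊢
          linarith
        have hlz := laplacian_nonneg_of_isLocalMin (hu.contDiffAt hzb hsT) hlmin
        have hlw := laplacian_le_of_isLocalMin_sub (hu.contDiffAt hwb hsT) contDiffAt_const hlmax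
        rw [InnerProductSpace.laplacian_const, Pi.zero_apply] at hlw
        have hder := ((hu.hasDerivAt_time hzb hsT).sub (hu.hasDerivAt_time hwb hsT)).add
          (((hasDerivAt_id s).const_mul k).exp.const_mul ε)
        have hle := HasDerivWithinAt.nonpos_of_le_left hder.hasDerivWithinAt (by
          filter_upwards [Ioo_mem_nhdsLT hs.1] with r hr
          have := hpast r ⟨hr.1.le, hr.2⟩
          simp only [Pi.add_apply, Pi.sub_apply, id]
          linarith)
        have hexp := exp_mul_sub_exp_mul_le hp.le (a := u z s) (c := u w s) (by linarith)
          (hB w (ball_subset_closedBall hwb) s ⟨hs.1.le, hs.2⟩)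
        have hexp' := mul_le_mul_of_nonneg_left hexp hlam.le
        have hdiff : u w s - u z s = ε * Real.exp (k * s) := by linarith
        rw [hdiff] at hexp'
        simp only [id, mul_one] at hle
        have h3 : ε * (Real.exp (k * s) * k) = lam * (p * Real.exp (p * B) *
          (ε * Real.exp (k * s))) + ε * Real.exp (k * s) := by rw [hk, hCf]; ring
        rw [h3] at hle
        linarith
      -- Here `z` minimises `u(·,s)` over an annulus touching the sphere, which the positive flux
      -- forbids.
      · have hzs : z ∈ sphere (0 : EuclideanSpace ℝ (Fin n)) R := mem_sphere_zero_iff_norm.2 hzR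
        exact ((hu.boundary z hzs s hsT).nonpos_of_le (norm_nonneg w) hwR hzs hminz).not_gt
          (Real.exp_pos _)
  refine le_of_forall_pos_le_add fun δ hδ => ?_
  have := key (δ / Real.exp (k * t)) (by positivity)
  have h2 : δ / Real.exp (k * t) * Real.exp (k * t) = δ := by field_simp
  linarith

/-- Comparison with an explicit supersolution: a solution bounded by `M` at time `t₀` stays below
`M + 2` at least until the time `t₀ + 1 / D`. -/
theorem lt_add_two (hu : IsClassicalSolution R T lam p q u₀ u) (hR : 0 < R)
    (hlam : 0 < lam) (hp : 0 < p) (hq : 0 < q) {t₀ M G D : ℝ} (ht₀ : 0 < t₀)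
    (hM : ∀ x ∈ closedBall (0 : EuclideanSpace ℝ (Fin n)) R, u x t₀ ≤ M)
    (hG : G = Real.exp (q * (M + 2)))
    (hD : D = n * G / R + G ^ 2 + lam * Real.exp (p * (M + 2)))
    {t : ℝ} (ht : t₀ ≤ t) (htT : t < T) (htD : D * (t - t₀) < 1)
    {x : EuclideanSpace ℝ (Fin n)} (hx : x ∈ closedBall 0 R) : u x t < M + 2 := by
  have hG0 : 0 < G := hG ▸ Real.exp_pos _
  have hD0 : 0 < D := by rw [hD]; positivity
  -- The barrier's exponential term is normalised by `c` to equal 1 on the sphere, where its normal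
  -- derivative is `2κR = G`. Its Laplacian is at most `nG/R + G²`, the first two terms of `D`.
  set κ := G / (2 * R) with hκ
  have hκ0 : 0 < κ := by positivity
  have hκR : 2 * κ * R = G := by rw [hκ]; field_simp
  have hIoo : ∀ s ∈ Ioc t₀ t, s ∈ Ioo 0 T := fun s hs => ⟨ht₀.trans hs.1, hs.2.trans_lt htT⟩
  have hDs : ∀ s ∈ Icc t₀ t, D * (s - t₀) < 1 := fun s hs =>
    lt_of_le_of_lt (by have := hs.2; gcongr) htD
  set c := Real.exp (-(κ * R ^ 2)) with hc
  have hh0 : ∀ y : EuclideanSpace ℝ (Fin n), 0 < c * Real.exp (κ * ‖y‖ ^ 2) := fun y => by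
    positivity
  have hh1 : ∀ y ∈ closedBall (0 : EuclideanSpace ℝ (Fin n)) R,
      c * Real.exp (κ * ‖y‖ ^ 2) ≤ 1 := fun y hy => by
    rw [hc, ← Real.exp_add, Real.exp_le_one_iff]
    have : ‖y‖ ^ 2 ≤ R ^ 2 := by
      have := mem_closedBall_zero_iff.1 hy
      gcongr
    nlinarith
  have hpos := pos_on_closedBall (a := t₀) (b := t)
    (g := fun x s => (M + D * (s - t₀) + c * Real.exp (κ * ‖x‖ ^ 2)) - u x s) hR ?_ ?_ ?_ ?_ x hx t
    ⟨ht, le_rfl⟩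
  · have := hh1 x hx
    linarith
  · exact ContinuousOn.sub (by fun_prop) (hu.continuousOn.mono
      (prod_mono le_rfl fun s hs => ⟨ht₀.le.trans hs.1, hs.2.trans_lt htT⟩))
  · intro y hy
    have := hM y hy
    have := hh0 y
    simp only [sub_self, mul_zero, add_zero]
    linarith
  · intro y hy s hs h0 hmin
    have hsT := hIoo s hs
    have hyb := ball_subset_closedBall hy
    refine ⟨_, ?_, (((((hasDerivAt_id s).sub_const t₀).const_mul D).const_add M).add_const
      (c * Real.exp (κ * ‖y‖ ^ 2))).sub (hu.hasDerivAt_time hy hsT)⟩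
    have hlap := laplacian_le_of_isLocalMin_sub (hu.contDiffAt hy hsT)
      (contDiffAt_const.add (contDiffAt_const.mul (contDiff_exp_mul_norm_sq κ).contDiffAt)) hmin
    rw [laplacian_const_add_mul_exp, finrank_euclideanSpace_fin] at hlap
    have hyR : ‖y‖ ^ 2 ≤ R ^ 2 := by
      have := (mem_ball_zero_iff.1 hy).le
      gcongr
    have h1 : (2 * κ * n + 4 * κ ^ 2 * ‖y‖ ^ 2) * (c * Real.exp (κ * ‖y‖ ^ 2)) ≤
        (2 * κ * n + 4 * κ ^ 2 * R ^ 2) * 1 := by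
      have := hh1 y hyb
      have := (hh0 y).le
      gcongr
    have h2 : (2 * κ * n + 4 * κ ^ 2 * R ^ 2) * 1 = n * G / R + G ^ 2 := by
      rw [hκ]; field_simp; ring
    -- At a contact point `u` equals the barrier, which is below `M + 1 + 1`; this makes the
    -- comparison with `G` and `D` strict.
    have h3 : u y s < M + 2 := by linarith [hDs s ⟨hs.1.le, hs.2⟩, hh1 y hyb]
    have h4 : lam * Real.exp (p * u y s) < lam * Real.exp (p * (M + 2)) := by gcongr
    linarith
  · intro y hy s hs h0
    have hyn : ‖y‖ = R := mem_sphere_zero_iff_norm.1 hy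
    refine ⟨_, ?_, (hasOutwardNormalDeriv_const_add_mul_exp (M + D * (s - t₀)) c κ y).sub
      (hu.boundary y hy s (hIoo s hs))⟩
    have h3 : u y s < M + 2 := by
      linarith [hDs s ⟨hs.1.le, hs.2⟩, hh1 y (sphere_subset_closedBall hy)]
    have h4 : c * Real.exp (κ * ‖y‖ ^ 2) = 1 := by
      rw [hc, ← Real.exp_add, hyn, neg_add_cancel, Real.exp_zero]
    have h5 : Real.exp (q * u y s) < G := by rw [hG]; gcongr
    rw [h4, hyn, hκR]
    linarith

end IsClassicalSolution

/-! ### The lower blow-up rate -/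

theorem theorem3p1 (n : ℕ) (hn : 1 ≤ n) (R T lam p q : ℝ) (hR : 0 < R) (hT : 0 < T)
    (hlam : 0 < lam) (hp : 0 < p) (hq : 0 < q)
    (u₀ : EuclideanSpace ℝ (Fin n) → ℝ) (u : EuclideanSpace ℝ (Fin n) → ℝ → ℝ)
    (hu₀ : IsAdmissibleDatum R lam p q u₀)
    (hu : IsClassicalSolution R T lam p q u₀ u)
    (hblow : BlowsUpAt R T u) :
    ∃ c : ℝ, 0 < c ∧ ∀ t ∈ Ioo 0 T, ∀ x ∈ sphere (0 : EuclideanSpace ℝ (Fin n)) R,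
      Real.log c - 1 / (2 * max p q) * Real.log (T - t) ≤ u x t := by
  set α := max p q with hα
  have hpα : p ≤ α := le_max_left _ _
  have hqα : q ≤ α := le_max_right _ _
  have hα0 : 0 < α := hp.trans_le hpα
  have hinit : ∀ x ∈ closedBall (0 : EuclideanSpace ℝ (Fin n)) R, u x 0 = u₀ x := fun x hx =>
    hu.initial_closedBall hR hT hu₀.smooth.continuousOn hx
  have hnn : ∀ x ∈ closedBall (0 : EuclideanSpace ℝ (Fin n)) R, ∀ t ∈ Ico 0 T, 0 ≤ u x t :=
    fun x hx t ht => hu.nonneg hR hlam (fun y hy => by rw [hinit y hy]; exact hu₀.nonneg y hy) hx ht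
  -- The factor `e^{4α}` comes from `e^{2α(M+2)} = e^{4α} e^{2αM}`.
  set C := (n / R + 1 + lam) * Real.exp (4 * α) with hC
  have hC0 : 0 < C := by positivity
  -- The witness is `C^{-1/(2α)}`.
  refine ⟨Real.exp (-(Real.log C / (2 * α))), Real.exp_pos _, fun t ht x hx => ?_⟩
  have hxb := sphere_subset_closedBall hx
  have hxn : ‖x‖ = R := mem_sphere_zero_iff_norm.1 hx
  set M := u x t with hM
  have hM0 : 0 ≤ M := hnn x hxb t ⟨ht.1.le, ht.2⟩
  have hmax : ∀ y ∈ closedBall (0 : EuclideanSpace ℝ (Fin n)) R, u y t ≤ M := fun y hy =>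
    hu.le_of_norm_le hR hlam hp hq
      (fun a ha b hb hab => by
        rw [hinit a ha, hinit b hb]; exact hu₀.nondecreasing a ha b hb hab)
      hxb (by rw [hxn]; exact mem_closedBall_zero_iff.1 hy) ⟨ht.1.le, ht.2⟩
  set G := Real.exp (q * (M + 2)) with hG
  set D := n * G / R + G ^ 2 + lam * Real.exp (p * (M + 2)) with hD
  -- Otherwise `u < M + 2` on all of `(t, T)`, and with `u ≥ 0` this bounds `|u|` up to `T`.
  have hlife : 1 ≤ D * (T - t) := by
    by_contra! hlt
    obtain ⟨s, ⟨y, hy, hys⟩, hs⟩ := ((hblow (M + 2)).and_eventually (Ioo_mem_nhdsLT ht.2)).exists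
    have hD0 : 0 ≤ D := by positivity
    have hub := hu.lt_add_two hR hlam hp hq ht.1 hmax hG hD hs.1.le hs.2
      (lt_of_le_of_lt (by have := hs.2.le; gcongr) hlt) hy
    rw [abs_of_nonneg (hnn y hy s ⟨(ht.1.trans hs.1).le, hs.2⟩)] at hys
    exact hys.not_gt hub
  have hDC : D ≤ C * Real.exp (2 * α * M) := by
    -- Nonnegativity of `M` lets the single exponents in `G` and in the reaction be absorbed into
    -- the doubled one coming from `G²`.
    have h0 : 0 ≤ α * (M + 2) := by positivity
    have hG1 : G ≤ Real.exp (2 * (α * (M + 2))) := by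
      refine Real.exp_le_exp.2 ?_
      have : q * (M + 2) ≤ α * (M + 2) := by gcongr
      linarith
    have hG2 : G ^ 2 ≤ Real.exp (2 * (α * (M + 2))) := by
      rw [hG, ← Real.exp_nat_mul]
      refine Real.exp_le_exp.2 ?_
      push_cast
      gcongr
    have hF : Real.exp (p * (M + 2)) ≤ Real.exp (2 * (α * (M + 2))) := by
      refine Real.exp_le_exp.2 ?_
      have : p * (M + 2) ≤ α * (M + 2) := by gcongr
      linarith
    have hE : C * Real.exp (2 * α * M) = n * Real.exp (2 * (α * (M + 2))) / R +
        Real.exp (2 * (α * (M + 2))) + lam * Real.exp (2 * (α * (M + 2))) := by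
      have : Real.exp (2 * (α * (M + 2))) = Real.exp (4 * α) * Real.exp (2 * α * M) := by
        rw [← Real.exp_add]; ring_nf
      rw [this, hC]; ring
    rw [hE, hD]
    gcongr
  have hTt : 0 < T - t := sub_pos.2 ht.2
  have hlog : 0 ≤ Real.log C + 2 * α * M + Real.log (T - t) := by
    have h1 : 1 ≤ C * Real.exp (2 * α * M) * (T - t) := hlife.trans (by gcongr)
    have h2 := Real.log_nonneg h1
    rwa [Real.log_mul (by positivity) hTt.ne', Real.log_mul hC0.ne' (by positivity),
      Real.log_exp] at h2
  rw [Real.log_exp]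
  have h3 : M - (-(Real.log C / (2 * α)) - 1 / (2 * α) * Real.log (T - t)) =
      (Real.log C + 2 * α * M + Real.log (T - t)) / (2 * α) := by
    field_simp; ring
  have h4 : 0 ≤ (Real.log C + 2 * α * M + Real.log (T - t)) / (2 * α) := by positivity
  linarith
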